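/- **Setting.** Let $n,d$ be integers, $0<\gamma<2$, and let $P_0,P_1$ be probability distributions on $\mathbb{R}^d$ (the laws of $(X\mid Y=0)$ and $(X\mid Y=1)$). Let $X^{y,j}$, $y\in\{0,1\}$, $1\le j\le n$, be $2n$ independent random vectors with $X^{y,j}\sim P_y$. Let $\Phi,\phi$ be the distribution function and the density of $N(0,1)$, with $\Phi^{-1}(0)=-\infty$, $\Phi^{-1}(1)=+\infty$. Put $$a_n=\sqrt{\gamma\log n},\quad g(n,\gamma)=\frac{\phi(a_n)}{2a_n},\quad \bar\delta_{n,d,\gamma}=\Big[\frac{3\log(d\,n^{\gamma/2})}{n\,g(2n,\gamma)}\Big]^{1/2},\quad J_1=\frac1{12\pi\sqrt{2\pi}} ,$$ and assume $a_n\ge 1$ and $\bar\delta_{n,d,\gamma}<1$. Let $F_{i|y}$ be the distribution function of the $i$th coordinate under $P_y$, $\alpha_{i|y}=\Phi^{-1}\circ F_{i|y}$, $\Delta\alpha_i=\alpha_{i|0}-\alpha_{i|1}$ (a difference of two equal infinite values being $0$), and, for $x\in\mathbb{R}^d$, $S''_x=\{i:\Delta\alpha_i(x_i)\ne 0\}$,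 $s''_x=|S''_x|$. Let $\widehat F_{i|y}$ be the empirical distribution function of $X^{y,1}_i,\dots,X^{y,n}_i$, $\widehat F_i=\frac12(\widehat F_{i|0}+\widehat F_{i|1})$ and $\widehat\alpha_{i|y}=\Phi^{-1}\circ\widehat F_{i|y}$. Set $\widetilde{\Delta\alpha}_i(t)=0$ if $\widehat F_i(t)\le 4g(2n,\gamma)$, or $\widehat F_i(t)\ge 1-4g(2n,\gamma)$, or $$\max\left\{\frac{\max\{\widehat F_{i|0}(t),\widehat F_{i|1}(t)\}}{\min\{\widehat F_{i|0}(t),\widehat F_{i|1}(t)\}},\frac{\max\{1-\widehat F_{i|0}(t),1-\widehat F_{i|1}(t)\}}{\min\{1-\widehat F_{i|0}(t),1-\widehat F_{i|1}(t)\}}\right\}\le\frac{1+\bar\delta_{n,d,\gamma}}{1-\bar\delta_{n,d,\gamma}}$$ (with $c/0=+\infty$ for $c>0$), and $\widetilde{\Delta\alpha}_i(t)=\widehat\alpha_{i|0}(t)-\widehat\alpha_{i|1}(t)$ otherwise. Let $\widetilde S''_x=\{i:\widetilde{\Delta\alpha}_i(x_i)\neq0\}$, and for $\epsilon>0$ let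 $H'_{x,\epsilon}$ be the event that $\widetilde S''_x=S''_x$ and, for all $i\in S''_x$, $|\widehat\alpha_{i|y}(x_i)-\alpha_{i|y}(x_i)|<\epsilon$ for both $y\in\{0,1\}$ and $|\widetilde{\Delta\alpha}_i(x_i)-\Delta\alpha_i(x_i)|<2\epsilon$. **Assumptions.** The sample size satisfies $$\max\Big\{\tfrac d8 e^{-3n g(2n,\gamma)},\ 4e^{-n g(2n,\gamma)},\ 6\log\big(\tfrac1{2g(n,\gamma)}\big)e^{-n g(n,\gamma)/32}\Big\}\le n^{-\gamma/2},$$ and $x\in\mathbb{R}^d$ is such that for every $i\in S''_x$: $8g(2n,\gamma)\le F_{i|y}(x_i)\le 1-8g(2n,\gamma)$ for both $y\in\{0,1\}$, and at least one of the four ratios $$\frac{F_{i|0}(x_i)}{F_{i|1}(x_i)},\quad \frac{F_{i|1}(x_i)}{F_{i|0}(x_i)},\quad \frac{1-F_{i|0}(x_i)}{1-F_{i|1}(x_i)},\quad \frac{1-F_{i|1}(x_i)}{1-F_{i|0}(x_i)}$$ is larger than $\dfrac{(1+\bar\delta_{n,d,\gamma})(1+\bar\delta_{n,1,\gamma})}{(1-\bar\delta_{n,d,\gamma})(1-\bar\delta_{n,1,\gamma})}$.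 **Theorem.** Then 1. for every $i\in S''_x$, $\mathbb{P}\big(\widetilde{\Delta\alpha}_i(x_i)\ne0\big)\ge 1-3n^{-\gamma/2}$; 2. $\mathbb{P}\big(\widetilde S''_x=S''_x\big)\ge 1-(3s''_x+8)n^{-\gamma/2}$; 3. for every $\epsilon>0$, $\displaystyle \mathbb{P}\big(H'_{x,\epsilon}\big)\ge 1-(5s''_x+8)n^{-\gamma/2}-4s''_x\exp\Big(-J_1\frac{n^{1-\gamma/2}\epsilon^2}{\sqrt{\gamma\log n}}\Big).$ -/

import Mathlib

open MeasureTheory ProbabilityTheory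
open scoped ENNReal

namespace CopulaClassif

noncomputable section

/-! ### Tuning quantities -/

/-- `a_n = √(γ log n)`. -/
def aSeq (n : ℕ) (γ : ℝ) : ℝ := Real.sqrt (γ * Real.log n)

/-- `g(n,γ) = φ(a_n) / (2 a_n)`, with `φ` the standard normal density. -/
def gFun (n : ℕ) (γ : ℝ) : ℝ := gaussianPDFReal 0 1 (aSeq n γ) / (2 * aSeq n γ)

/-- `δ̄_{n,d,γ} = [3 n⁻¹ g(2n,γ)⁻¹ log (d n^{γ/2})]^{1/2}`. -/
def deltaBar (n d : ℕ) (γ : ℝ) : ℝ :=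
  Real.sqrt (3 * (n : ℝ)⁻¹ * (gFun (2 * n) γ)⁻¹ * Real.log (d * (n : ℝ) ^ (γ / 2)))

/-- The absolute constant `J₁ = (12 π √(2π))⁻¹`. -/
def J₁ : ℝ := (12 * Real.pi * Real.sqrt (2 * Real.pi))⁻¹

/-- The condition on the sample size. -/
def SampleSizeCondition (n d : ℕ) (γ : ℝ) : Prop :=
  max (max ((d : ℝ) / 8 * Real.exp (-(3 * n * gFun (2 * n) γ)))
        (4 * Real.exp (-(n * gFun (2 * n) γ))))
      (6 * Real.log ((gFun n γ)⁻¹ / 2) * Real.exp (-(1 / 32 * n * gFun n γ)))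
    ≤ (n : ℝ) ^ (-(γ / 2))

/-! ### Normal quantiles and the transformation functions

`Φ⁻¹(0) = -∞` and `Φ⁻¹(1) = +∞` are genuine values here: an empirical distribution function takes
the values `0` and `1` with positive probability. -/

/-- The quantile function `p ↦ inf {z : p ≤ Φ(z)}` of `N(0,1)`, with values in `[-∞, +∞]`. -/
def normalQuantile (p : ℝ) : EReal :=
  sInf ((fun z : ℝ => (z : EReal)) '' {z : ℝ | p ≤ cdf (gaussianReal 0 1) z})

open Classical in
/-- The difference of two extended reals, equal to `0` when the two agree
(also if both are `+∞` or both are `-∞`). -/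
def extDiff (a b : EReal) : EReal := if a = b then 0 else a - b

section Population

variable {d : ℕ} (μ : Fin 2 → Measure (Fin d → ℝ))

/-- `F_{i|y}`, the distribution function of the `i`th coordinate under the class-`y` law `μ y`. -/
def popF (i : Fin d) (y : Fin 2) (t : ℝ) : ℝ :=
  cdf ((μ y).map (fun x : Fin d → ℝ => x i)) t

/-- `α_{i|y} = Φ⁻¹ ∘ F_{i|y}`. -/
def alpha (i : Fin d) (y : Fin 2) (t : ℝ) : EReal := normalQuantile (popF μ i y t)

/-- `Δα_i = α_{i|0} - α_{i|1}`. -/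
def deltaAlpha (i : Fin d) (t : ℝ) : EReal := extDiff (alpha μ i 0 t) (alpha μ i 1 t)

/-- `S''_x = {i : Δα_i(x_i) ≠ 0}`. -/
def suppSet (x : Fin d → ℝ) : Set (Fin d) := {i | deltaAlpha μ i (x i) ≠ 0}

/-- `B_{n,γ,i,y}`: the points at which `F_{i|y}` is moderate. -/
def moderateSet (n : ℕ) (γ : ℝ) (i : Fin d) (y : Fin 2) : Set ℝ :=
  {t | 8 * gFun (2 * n) γ ≤ popF μ i y t ∧ popF μ i y t ≤ 1 - 8 * gFun (2 * n) γ}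

/-- The signal-strength threshold
`(1 + δ̄_{n,d,γ})(1 + δ̄_{n,1,γ}) / ((1 - δ̄_{n,d,γ})(1 - δ̄_{n,1,γ}))`. -/
def signalThreshold (n d : ℕ) (γ : ℝ) : ℝ :=
  ((1 + deltaBar n d γ) * (1 + deltaBar n 1 γ)) /
    ((1 - deltaBar n d γ) * (1 - deltaBar n 1 γ))

/-- `B^δ_{n,d,γ,i}`: the points at which `F_{i|0}` and `F_{i|1}` are well separated. -/
def signalSet (n : ℕ) (γ : ℝ) (i : Fin d) : Set ℝ :=
  {t | popF μ i 0 t / popF μ i 1 t > signalThreshold n d γ ∨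
       popF μ i 1 t / popF μ i 0 t > signalThreshold n d γ ∨
       (1 - popF μ i 0 t) / (1 - popF μ i 1 t) > signalThreshold n d γ ∨
       (1 - popF μ i 1 t) / (1 - popF μ i 0 t) > signalThreshold n d γ}

/-- `A^F_{n,d,γ} = A^{F,1}_{n,d,γ} ∩ A^{F,2}_{n,d,γ}`. -/
def goodPoints (n : ℕ) (γ : ℝ) : Set (Fin d → ℝ) :=
  {x | ∀ i ∈ suppSet μ x, x i ∈ moderateSet μ n γ i 0 ∩ moderateSet μ n γ i 1} ∩
  {x | ∀ i ∈ suppSet μ x, x i ∈ signalSet μ n γ i}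

end Population

section Estimators

variable {n d : ℕ} (D : Fin 2 → Fin n → Fin d → ℝ)

/-- `F̂_{i|y}`, the empirical distribution function of the `i`th coordinate of the class-`y`
sample; the data are `D y j i = X^{y,j}_i`. -/
def empF (i : Fin d) (y : Fin 2) (t : ℝ) : ℝ :=
  (∑ j : Fin n, if D y j i ≤ t then (1 : ℝ) else 0) / n

/-- `F̂_i = (F̂_{i|0} + F̂_{i|1}) / 2`. -/
def empFMarg (i : Fin d) (t : ℝ) : ℝ := (empF D i 0 t + empF D i 1 t) / 2

/-- `α̂_{i|y} = Φ⁻¹ ∘ F̂_{i|y}`. -/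
def alphaHat (i : Fin d) (y : Fin 2) (t : ℝ) : EReal := normalQuantile (empF D i y t)

/-- The first test: the empirical marginal distribution function is close to `0` or to `1`. -/
def BoundaryTest (γ : ℝ) (i : Fin d) (t : ℝ) : Prop :=
  empFMarg D i t ≤ 4 * gFun (2 * n) γ ∨ empFMarg D i t ≥ 1 - 4 * gFun (2 * n) γ

/-- `max{a,b} / min{a,b}` for `a, b ≥ 0`; it is `+∞` if exactly one of them is `0`. -/
def maxMinRatio (a b : ℝ) : ℝ≥0∞ := ENNReal.ofReal (max a b) / ENNReal.ofReal (min a b)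

/-- The second test: the two empirical distribution functions are close. (A ratio is `0/0` only
if both are `0` or both are `1`, and then the first test holds.) -/
def ClosenessTest (γ : ℝ) (i : Fin d) (t : ℝ) : Prop :=
  max (maxMinRatio (empF D i 0 t) (empF D i 1 t))
      (maxMinRatio (1 - empF D i 0 t) (1 - empF D i 1 t))
    ≤ ENNReal.ofReal ((1 + deltaBar n d γ) / (1 - deltaBar n d γ))

open Classical in
/-- The sparse estimator `Δ̃α_i(t)`. -/
def deltaAlphaTilde (γ : ℝ) (i : Fin d) (t : ℝ) : EReal :=
  if BoundaryTest D γ i t ∨ ClosenessTest D γ i t then 0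
  else extDiff (alphaHat D i 0 t) (alphaHat D i 1 t)

/-- `S̃''_x = {i : Δ̃α_i(x_i) ≠ 0}`. -/
def suppSetTilde (γ : ℝ) (x : Fin d → ℝ) : Set (Fin d) :=
  {i | deltaAlphaTilde D γ i (x i) ≠ 0}

/-- The defining property of the accuracy event `H'_{x,ε}`, for the data set `D`. -/
def AccuracyEvent (μ : Fin 2 → Measure (Fin d → ℝ)) (γ : ℝ) (x : Fin d → ℝ) (ε : ℝ) : Prop :=
  suppSetTilde D γ x = suppSet μ x ∧
  ∀ i ∈ suppSet μ x,
    (∀ y : Fin 2, (alphaHat D i y (x i) - alpha μ i y (x i)).abs < ENNReal.ofReal ε) ∧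
    (deltaAlphaTilde D γ i (x i) - deltaAlpha μ i (x i)).abs < ENNReal.ofReal (2 * ε)

end Estimators

end

end CopulaClassif

open CopulaClassif

namespace CopulaClassif

/-! ### The standard normal distribution function and its quantiles -/

/-! At a fixed coordinate everything depends on two averages of `n` independent indicators, with
means `F_{i|0}(x_i)` and `F_{i|1}(x_i)`. The theorem is a union bound over multiplicative Chernoff
estimates for these averages. Write `v = n^(-γ/2)` and `g = g(2n,γ)`. The width `δ̄` is tuned so
that `exp(-n g δ̄_{n,d}² / 3) = v / d` (`exp_deltaBar_sq`).

False positives: off the support `Φ⁻¹` is injective, so both means equal some `q`. If `q` or `1 - q`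
is at most `g`, the boundary test fires except with probability `exp(-3ng) ≤ 8v/d`. Otherwise each
of the two ratios leaves its allowed range with probability at most `4v/d`. At most `d` coordinates
cost `8v` in total.

False negatives: on the support the means keep distance `8g` from `0` and `1`, so the two boundary
conditions hold with total probability at most `2 exp(-ng) ≤ v/2`. The signal exceeds the test
threshold by the factor `(1 + δ̄_{n,1}) / (1 - δ̄_{n,1})`, so the closeness test holds with
probability at most `2v`. Each coordinate costs at most `3v`.

Accuracy: the normal density dominates `min(Φ, 1 - Φ)` up to a constant, so quantiles `ε` apart
force levels apart relative to their distance from `0` and `1`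
(`le_abs_sub_of_le_abs_normalQuantile_sub`). Chernoff then costs `v + 2E` per coordinate and class,
where `E` is the exponential term with `J₁` (`UnitArray.quantile_rowAvg_tail`, `J₁_exponent_le`). -/

theorem gaussian_cdf_sub_eq_integral {z w : ℝ} (hzw : z ≤ w) :
    cdf (gaussianReal 0 1) w - cdf (gaussianReal 0 1) z
      = ∫ t in Set.Ioc z w, gaussianPDFReal 0 1 t := by
  rw [cdf_eq_real, cdf_eq_real, ← Set.Iic_union_Ioc_eq_Iic hzw,
    measureReal_union (Set.Iic_disjoint_Ioc le_rfl) measurableSet_Ioc, add_sub_cancel_left,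
    measureReal_def, gaussianReal_apply_eq_integral 0 one_ne_zero, ENNReal.toReal_ofReal]
  exact integral_nonneg fun t => gaussianPDFReal_nonneg 0 1 t

theorem gaussian_cdf_strictMono : StrictMono (cdf (gaussianReal 0 1)) := by
  intro z w hzw
  rw [← sub_pos, gaussian_cdf_sub_eq_integral hzw.le,
    ← intervalIntegral.integral_of_le hzw.le]
  exact intervalIntegral.intervalIntegral_pos_of_pos
    (integrable_gaussianPDFReal 0 1).intervalIntegrable
    (fun t => gaussianPDFReal_pos 0 1 t one_ne_zero) hzw

theorem gaussian_cdf_continuous : Continuous (cdf (gaussianReal 0 1)) := by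
  have h : (fun x => cdf (gaussianReal 0 1) x)
      = fun x => cdf (gaussianReal 0 1) 0 + ∫ t in (0 : ℝ)..x, gaussianPDFReal 0 1 t := by
    funext x
    rcases le_total 0 x with hx | hx
    · rw [intervalIntegral.integral_of_le hx, ← gaussian_cdf_sub_eq_integral hx]; ring
    · rw [intervalIntegral.integral_of_ge hx, ← gaussian_cdf_sub_eq_integral hx]; ring
  change Continuous (fun x => cdf (gaussianReal 0 1) x)
  rw [h]
  exact continuous_const.add (intervalIntegral.continuous_primitive
    (fun a b => (integrable_gaussianPDFReal 0 1).intervalIntegrable) 0)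

theorem gaussian_cdf_lt_one (z : ℝ) : cdf (gaussianReal 0 1) z < 1 :=
  (gaussian_cdf_strictMono (by linarith : z < z + 1)).trans_le (cdf_le_one _ (z + 1))

theorem gaussian_cdf_neg (z : ℝ) :
    cdf (gaussianReal 0 1) (-z) = 1 - cdf (gaussianReal 0 1) z := by
  have hmap : (gaussianReal 0 1).map (fun y : ℝ => -y) = gaussianReal 0 1 := by
    simpa using gaussianReal_map_neg (μ := 0) (v := 1)
  have : NullSingletonClass (gaussianReal 0 1) := nullSingletonClass_gaussianReal one_ne_zero
  have h : (gaussianReal 0 1).real (Set.Iic (-z)) = (gaussianReal 0 1).real (Set.Ici z) := by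
    conv_lhs => rw [← hmap]
    rw [map_measureReal_apply measurable_neg measurableSet_Iic]
    congr 1
    ext y
    simp
  rw [cdf_eq_real, cdf_eq_real, h, ← Set.compl_Iio, probReal_compl_eq_one_sub measurableSet_Iio,
    measureReal_congr Iio_ae_eq_Iic]

theorem exists_gaussian_cdf_eq {p : ℝ} (h0 : 0 < p) (h1 : p < 1) :
    ∃ z : ℝ, cdf (gaussianReal 0 1) z = p := by
  obtain ⟨a, ha⟩ := ((tendsto_cdf_atBot (gaussianReal 0 1)).eventually_lt_const h0).exists
  obtain ⟨b, hb⟩ := ((tendsto_cdf_atTop (gaussianReal 0 1)).eventually_const_lt h1).exists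
  exact mem_range_of_exists_le_of_exists_ge gaussian_cdf_continuous ⟨a, ha.le⟩ ⟨b, hb.le⟩

theorem normalQuantile_cdf (z : ℝ) :
    normalQuantile (cdf (gaussianReal 0 1) z) = (z : EReal) := by
  have : {w : ℝ | cdf (gaussianReal 0 1) z ≤ cdf (gaussianReal 0 1) w} = Set.Ici z := by
    ext w
    exact gaussian_cdf_strictMono.le_iff_le
  rw [normalQuantile, this]
  refine le_antisymm (sInf_le ⟨z, Set.self_mem_Ici, rfl⟩) (le_sInf ?_)
  rintro _ ⟨w, hw, rfl⟩
  exact EReal.coe_le_coe_iff.2 hw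

theorem normalQuantile_zero : normalQuantile 0 = ⊥ := by
  refine (EReal.eq_bot_iff_forall_lt _).2 fun y => ?_
  have h : normalQuantile 0 ≤ ((y - 1 : ℝ) : EReal) :=
    sInf_le (Set.mem_image_of_mem _ (cdf_nonneg _ (y - 1)))
  refine h.trans_lt ?_
  exact EReal.coe_lt_coe_iff.2 (sub_one_lt y)

theorem normalQuantile_one : normalQuantile 1 = ⊤ := by
  have : {w : ℝ | 1 ≤ cdf (gaussianReal 0 1) w} = ∅ :=
    Set.eq_empty_of_forall_notMem fun w hw => (gaussian_cdf_lt_one w).not_ge hw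
  rw [normalQuantile, this, Set.image_empty, sInf_empty]

/-- Injectivity includes the endpoints, whose quantiles are infinite. It serves both ways: equal
population quantiles give equal levels, and distinct empirical levels give a nonzero estimate. -/
theorem normalQuantile_injOn : Set.InjOn normalQuantile (Set.Icc 0 1) := by
  have key : ∀ p ∈ Set.Icc (0 : ℝ) 1, (p = 0 ∧ normalQuantile p = ⊥) ∨
      (p = 1 ∧ normalQuantile p = ⊤) ∨
      ∃ z : ℝ, p = cdf (gaussianReal 0 1) z ∧ normalQuantile p = (z : EReal) := by
    intro p hp
    rcases hp.1.eq_or_lt with rfl | h0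
    · exact Or.inl ⟨rfl, normalQuantile_zero⟩
    rcases hp.2.eq_or_lt with rfl | h1
    · exact Or.inr (Or.inl ⟨rfl, normalQuantile_one⟩)
    obtain ⟨z, rfl⟩ := exists_gaussian_cdf_eq h0 h1
    exact Or.inr (Or.inr ⟨z, rfl, normalQuantile_cdf z⟩)
  intro p hp q hq h
  rcases key p hp with ⟨rfl, hp'⟩ | ⟨rfl, hp'⟩ | ⟨z, rfl, hp'⟩ <;>
  rcases key q hq with ⟨rfl, hq'⟩ | ⟨rfl, hq'⟩ | ⟨w, rfl, hq'⟩ <;>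
  have h' := hp'.symm.trans (h.trans hq') <;>
  first
    | rfl
    | rw [EReal.coe_injective h']
    | exact absurd h' (by simp)

/-- A Mills-ratio bound, without the factor that improves it in the tail. -/
theorem one_sub_gaussian_cdf_le {t : ℝ} (ht : 0 ≤ t) :
    1 - cdf (gaussianReal 0 1) t ≤ gaussianPDFReal 0 1 t * (Real.sqrt (2 * Real.pi) / 2) := by
  have hs : 0 < Real.sqrt (2 * Real.pi) := by positivity
  have hzero : cdf (gaussianReal 0 1) 0 = 1 / 2 := by
    have := gaussian_cdf_neg 0
    rw [neg_zero] at this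
    linarith
  have htail : ∀ u : ℝ, 1 - cdf (gaussianReal 0 1) u = (gaussianReal 0 1).real (Set.Ioi u) := by
    intro u
    rw [← Set.compl_Iic, probReal_compl_eq_one_sub measurableSet_Iic, cdf_eq_real]
  have hint : ∀ m u : ℝ, (gaussianReal m 1).real (Set.Ioi u)
      = ∫ s in Set.Ioi u, gaussianPDFReal m 1 s := by
    intro m u
    rw [measureReal_def, gaussianReal_apply_eq_integral m one_ne_zero, ENNReal.toReal_ofReal]
    exact integral_nonneg fun s => gaussianPDFReal_nonneg m 1 s
  have hhalf : (gaussianReal t 1).real (Set.Ioi t) = 1 / 2 := by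
    have hmap : (gaussianReal 0 1).map (· + t) = gaussianReal t 1 := by
      simpa using gaussianReal_map_add_const (μ := 0) (v := 1) t
    have hpre : (· + t) ⁻¹' Set.Ioi t = Set.Ioi (0 : ℝ) := by ext u; simp
    rw [← hmap, map_measureReal_apply (measurable_add_const t) measurableSet_Ioi, hpre,
      ← htail, hzero]
    norm_num
  -- For `s ≥ t ≥ 0` one has `s² ≥ t² + (s - t)²`, so the tail is compared with a normal law centred
  -- at `t`, which has mass `1/2` beyond `t`.
  calc 1 - cdf (gaussianReal 0 1) t = ∫ s in Set.Ioi t, gaussianPDFReal 0 1 s := by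
        rw [htail, hint]
    _ ≤ ∫ s in Set.Ioi t,
          gaussianPDFReal 0 1 t * Real.sqrt (2 * Real.pi) * gaussianPDFReal t 1 s := by
        refine setIntegral_mono_on (integrable_gaussianPDFReal 0 1).integrableOn
          ((integrable_gaussianPDFReal t 1).integrableOn.const_mul _) measurableSet_Ioi
          fun s hs' => ?_
        have hts : t ≤ s := le_of_lt hs'
        simp only [gaussianPDFReal_def, NNReal.coe_one, mul_one, sub_zero]
        have : (Real.sqrt (2 * Real.pi))⁻¹ * Real.exp (-t ^ 2 / 2) * Real.sqrt (2 * Real.pi) *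
            ((Real.sqrt (2 * Real.pi))⁻¹ * Real.exp (-(s - t) ^ 2 / 2))
            = (Real.sqrt (2 * Real.pi))⁻¹ * Real.exp (-t ^ 2 / 2 + -(s - t) ^ 2 / 2) := by
          rw [Real.exp_add]
          field_simp
        rw [this]
        gcongr
        nlinarith [mul_nonneg ht (sub_nonneg.2 hts)]
    _ = gaussianPDFReal 0 1 t * (Real.sqrt (2 * Real.pi) / 2) := by
        rw [integral_const_mul, ← hint, hhalf]; ring

theorem min_gaussian_cdf_le (t : ℝ) :
    min (cdf (gaussianReal 0 1) t) (1 - cdf (gaussianReal 0 1) t)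
      ≤ gaussianPDFReal 0 1 t * (Real.sqrt (2 * Real.pi) / 2) := by
  rcases le_total 0 t with ht | ht
  · exact (min_le_right _ _).trans (one_sub_gaussian_cdf_le ht)
  · have h := one_sub_gaussian_cdf_le (neg_nonneg.2 ht)
    rw [gaussian_cdf_neg, sub_sub_cancel] at h
    have hφ : gaussianPDFReal 0 1 (-t) = gaussianPDFReal 0 1 t := by
      simp [gaussianPDFReal_def]
    rw [hφ] at h
    exact (min_le_left _ _).trans h

/-- The density on `[z, w]` is bounded below through `min_gaussian_cdf_le`; by monotonicity `Φ ≥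
Φ(z)` and `1 - Φ ≥ 1 - Φ(w)` there. -/
theorem mul_le_gaussian_cdf_sub {z w : ℝ} (hzw : z ≤ w) :
    (w - z) * (2 / Real.sqrt (2 * Real.pi) *
        min (cdf (gaussianReal 0 1) z) (1 - cdf (gaussianReal 0 1) w))
      ≤ cdf (gaussianReal 0 1) w - cdf (gaussianReal 0 1) z := by
  have hs : 0 < Real.sqrt (2 * Real.pi) := by positivity
  rw [gaussian_cdf_sub_eq_integral hzw]
  set c := 2 / Real.sqrt (2 * Real.pi) *
        min (cdf (gaussianReal 0 1) z) (1 - cdf (gaussianReal 0 1) w) with hc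
  have h := setIntegral_mono_on (μ := volume) (s := Set.Ioc z w) (f := fun _ => c)
    (g := gaussianPDFReal 0 1) (by simp) (integrable_gaussianPDFReal 0 1).integrableOn
    measurableSet_Ioc (fun t ht => by
      have h1 : min (cdf (gaussianReal 0 1) z) (1 - cdf (gaussianReal 0 1) w)
          ≤ min (cdf (gaussianReal 0 1) t) (1 - cdf (gaussianReal 0 1) t) :=
        min_le_min ((cdf (gaussianReal 0 1)).mono ht.1.le)
          (sub_le_sub_left ((cdf (gaussianReal 0 1)).mono ht.2) 1)
      have h2 := h1.trans (min_gaussian_cdf_le t)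
      calc c ≤ 2 / Real.sqrt (2 * Real.pi) *
            (gaussianPDFReal 0 1 t * (Real.sqrt (2 * Real.pi) / 2)) := by rw [hc]; gcongr
        _ = gaussianPDFReal 0 1 t := by field_simp)
  simpa [hzw] using h

/-- Quantiles that are `ε` apart have levels that are apart, relative to the distance of these
levels from `0` and `1`. -/
theorem le_abs_sub_of_le_abs_normalQuantile_sub {p q ε m : ℝ} (hp0 : 0 < p) (hp1 : p < 1)
    (hq0 : 0 < q) (hq1 : q < 1) (hm : 0 ≤ m)
    (hmp : m ≤ min p (1 - p)) (hmq : m ≤ min q (1 - q))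
    (h : ENNReal.ofReal ε ≤ (normalQuantile q - normalQuantile p).abs) :
    ε * (2 / Real.sqrt (2 * Real.pi) * m) ≤ |q - p| := by
  obtain ⟨z, rfl⟩ := exists_gaussian_cdf_eq hp0 hp1
  obtain ⟨w, rfl⟩ := exists_gaussian_cdf_eq hq0 hq1
  rw [normalQuantile_cdf, normalQuantile_cdf, ← EReal.coe_sub, EReal.abs_def,
    ENNReal.ofReal_le_ofReal_iff (abs_nonneg _)] at h
  rw [le_min_iff] at hmp hmq
  rcases le_total z w with hzw | hzw
  · rw [abs_of_nonneg (sub_nonneg.2 hzw)] at h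
    refine le_trans ?_ ((mul_le_gaussian_cdf_sub hzw).trans (le_abs_self _))
    have := le_min hmp.1 hmq.2
    have := sub_nonneg.2 hzw
    gcongr
  · rw [abs_sub_comm, abs_of_nonneg (sub_nonneg.2 hzw)] at h
    rw [abs_sub_comm]
    refine le_trans ?_ ((mul_le_gaussian_cdf_sub hzw).trans (le_abs_self _))
    have := le_min hmq.1 hmp.2
    have := sub_nonneg.2 hzw
    gcongr

/-! ### Chernoff bounds for sums of independent `[0,1]`-valued variables -/

section Chernoff

variable {Ω ι : Type*} [MeasurableSpace Ω] {P : Measure Ω} [IsProbabilityMeasure P]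
  {Z : ι → Ω → ℝ}

theorem integrable_of_mem_Icc {f : Ω → ℝ} (hf : Measurable f) {a b : ℝ}
    (h : ∀ ω, f ω ∈ Set.Icc a b) : Integrable f P :=
  Integrable.of_mem_Icc a b hf.aemeasurable (Filter.Eventually.of_forall h)

/-- Convexity puts the exponential below its chord over `[0, 1]`, and `1 + x ≤ exp x` yields the
Poisson form. Only the mean enters, so the variables of a sum may have different laws. -/
theorem mgf_le_of_mem_Icc {f : Ω → ℝ} (hf : Measurable f) (h : ∀ ω, f ω ∈ Set.Icc (0 : ℝ) 1)
    (t : ℝ) : mgf f P t ≤ Real.exp ((∫ ω, f ω ∂P) * (Real.exp t - 1)) := by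
  have hi : Integrable f P := integrable_of_mem_Icc hf h
  have hconv : ∀ ω, Real.exp (t * f ω) ≤ 1 + f ω * (Real.exp t - 1) := by
    intro ω
    have := convexOn_exp.2 (Set.mem_univ 0) (Set.mem_univ t)
      (sub_nonneg.2 (h ω).2) (h ω).1 (by ring)
    simp only [smul_eq_mul, mul_zero, zero_add, Real.exp_zero, mul_one] at this
    rw [mul_comm]
    linarith
  have hi' : Integrable (fun ω => 1 + f ω * (Real.exp t - 1)) P :=
    (integrable_const 1).add (hi.mul_const _)
  calc mgf f P t ≤ ∫ ω, (1 + f ω * (Real.exp t - 1)) ∂P := by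
        refine integral_mono_of_nonneg (Filter.Eventually.of_forall fun ω => (Real.exp_pos _).le)
          hi' (Filter.Eventually.of_forall hconv)
    _ = (∫ ω, f ω ∂P) * (Real.exp t - 1) + 1 := by
        rw [integral_add (integrable_const 1) (hi.mul_const _), integral_mul_const]
        simp [add_comm]
    _ ≤ _ := Real.add_one_le_exp _

theorem mgf_sum_le (hind : iIndepFun Z P) (hZ : ∀ k, Measurable (Z k))
    (h01 : ∀ k ω, Z k ω ∈ Set.Icc (0 : ℝ) 1) (s : Finset ι) (t : ℝ) :
    mgf (∑ k ∈ s, Z k) P t ≤ Real.exp ((∑ k ∈ s, ∫ ω, Z k ω ∂P) * (Real.exp t - 1)) := by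
  rw [hind.mgf_sum hZ, Finset.sum_mul, Real.exp_sum]
  exact Finset.prod_le_prod (fun k _ => mgf_nonneg) fun k _ => mgf_le_of_mem_Icc (hZ k) (h01 k) t

theorem integrable_exp_mul_sum (hZ : ∀ k, Measurable (Z k))
    (h01 : ∀ k ω, Z k ω ∈ Set.Icc (0 : ℝ) 1) (s : Finset ι) (t : ℝ) :
    Integrable (fun ω => Real.exp (t * (∑ k ∈ s, Z k) ω)) P := by
  refine integrable_of_mem_Icc (a := 0) (b := Real.exp (|t| * s.card)) ?_ fun ω =>
    ⟨(Real.exp_pos _).le, Real.exp_le_exp.2 ?_⟩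
  · simp only [Finset.sum_apply]
    exact Real.measurable_exp.comp ((Finset.measurable_sum s fun k _ => hZ k).const_mul t)
  · rw [Finset.sum_apply]
    have h0 : 0 ≤ ∑ k ∈ s, Z k ω := Finset.sum_nonneg fun k _ => (h01 k ω).1
    have h1 : ∑ k ∈ s, Z k ω ≤ s.card := by
      simpa using Finset.sum_le_sum (s := s) fun k _ => (h01 k ω).2
    exact mul_le_mul (le_abs_self t) h1 h0 (abs_nonneg t)

theorem measureReal_le_sum_le (hind : iIndepFun Z P) (hZ : ∀ k, Measurable (Z k))
    (h01 : ∀ k ω, Z k ω ∈ Set.Icc (0 : ℝ) 1) (s : Finset ι) {t : ℝ} (ht : 0 ≤ t) (a : ℝ) :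
    P.real {ω | a ≤ ∑ k ∈ s, Z k ω}
      ≤ Real.exp ((∑ k ∈ s, ∫ ω, Z k ω ∂P) * (Real.exp t - 1) - t * a) := by
  have h := measure_ge_le_exp_mul_mgf a ht (integrable_exp_mul_sum (P := P) hZ h01 s t)
  simp only [Finset.sum_apply] at h
  refine h.trans ((mul_le_mul_of_nonneg_left (mgf_sum_le hind hZ h01 s t)
    (Real.exp_pos _).le).trans_eq ?_)
  rw [← Real.exp_add]
  congr 1
  ring

theorem measureReal_sum_le_le (hind : iIndepFun Z P) (hZ : ∀ k, Measurable (Z k))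
    (h01 : ∀ k ω, Z k ω ∈ Set.Icc (0 : ℝ) 1) (s : Finset ι) {t : ℝ} (ht : 0 ≤ t) (a : ℝ) :
    P.real {ω | ∑ k ∈ s, Z k ω ≤ a}
      ≤ Real.exp ((∑ k ∈ s, ∫ ω, Z k ω ∂P) * (Real.exp (-t) - 1) + t * a) := by
  have h := measure_le_le_exp_mul_mgf a (neg_nonpos.2 ht)
    (integrable_exp_mul_sum (P := P) hZ h01 s (-t))
  simp only [Finset.sum_apply] at h
  refine h.trans ((mul_le_mul_of_nonneg_left (mgf_sum_le hind hZ h01 s (-t))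
    (Real.exp_pos _).le).trans_eq ?_)
  rw [← Real.exp_add]
  congr 1
  ring

/-- The product `(1 - x + x²/2)(1 + x + x²/2) = 1 + x⁴/4` is at least `1`. -/
theorem exp_neg_le_quadratic {x : ℝ} (hx : 0 ≤ x) : Real.exp (-x) ≤ 1 - x + x ^ 2 / 2 := by
  have h := Real.quadratic_le_exp_of_nonneg hx
  rw [Real.exp_neg, inv_le_iff_one_le_mul₀ (Real.exp_pos x)]
  have h2 : 0 ≤ 1 - x + x ^ 2 / 2 := by nlinarith [sq_nonneg (x - 1)]
  nlinarith [mul_le_mul_of_nonneg_left h h2, sq_nonneg (x ^ 2)]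

/-- The multiplicative Chernoff bound for the upper tail. -/
theorem measureReal_one_add_mul_le_sum_le (hind : iIndepFun Z P) (hZ : ∀ k, Measurable (Z k))
    (h01 : ∀ k ω, Z k ω ∈ Set.Icc (0 : ℝ) 1) (s : Finset ι) {m δ : ℝ}
    (hm : ∑ k ∈ s, ∫ ω, Z k ω ∂P = m) (hm0 : 0 ≤ m) (hδ0 : 0 ≤ δ) (hδ1 : δ ≤ 1) :
    P.real {ω | (1 + δ) * m ≤ ∑ k ∈ s, Z k ω} ≤ Real.exp (-(m * δ ^ 2 / 3)) := by
  have h1 : 0 < 1 + δ := by linarith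
  refine (measureReal_le_sum_le hind hZ h01 s (Real.log_nonneg (by linarith : 1 ≤ 1 + δ))
    _).trans (Real.exp_le_exp.2 ?_)
  rw [hm, Real.exp_log h1]
  have hlog := Real.le_log_one_add_of_nonneg hδ0
  -- From `log (1 + δ) ≥ 2δ / (δ + 2)`; what remains is `δ³ ≤ δ²`, which is where `δ ≤ 1` enters.
  have key : δ + δ ^ 2 / 3 ≤ (1 + δ) * Real.log (1 + δ) := by
    refine le_trans ?_ (mul_le_mul_of_nonneg_left hlog h1.le)
    rw [mul_div_assoc', le_div_iff₀ (by linarith)]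
    nlinarith [mul_nonneg (sq_nonneg δ) (sub_nonneg.2 hδ1)]
  nlinarith [mul_le_mul_of_nonneg_left key hm0]

/-- The multiplicative Chernoff bound for the lower tail. -/
theorem measureReal_sum_le_one_sub_mul_le (hind : iIndepFun Z P) (hZ : ∀ k, Measurable (Z k))
    (h01 : ∀ k ω, Z k ω ∈ Set.Icc (0 : ℝ) 1) (s : Finset ι) {m δ : ℝ}
    (hm : ∑ k ∈ s, ∫ ω, Z k ω ∂P = m) (hm0 : 0 ≤ m) (hδ0 : 0 ≤ δ) :
    P.real {ω | ∑ k ∈ s, Z k ω ≤ (1 - δ) * m} ≤ Real.exp (-(m * δ ^ 2 / 2)) := by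
  -- The choice `t = δ` in place of the optimal parameter already gives `-δ + δ²/2 + δ(1 - δ) =
  -- -δ²/2`.
  refine (measureReal_sum_le_le hind hZ h01 s hδ0 _).trans (Real.exp_le_exp.2 ?_)
  rw [hm]
  nlinarith [mul_le_mul_of_nonneg_left (exp_neg_le_quadratic hδ0) hm0]

end Chernoff

/-! ### Two rows of independent `[0,1]`-valued variables -/

/-- Two rows of `n` variables with values in `[0,1]`, all `2n` of them independent, the variables
of row `y` having mean `p y`. -/
structure UnitArray {Ω : Type*} [MeasurableSpace Ω] (P : Measure Ω) {n : ℕ}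
    (Z : Fin 2 → Fin n → Ω → ℝ) (p : Fin 2 → ℝ) : Prop where
  indep : iIndepFun (fun k : Fin 2 × Fin n => Z k.1 k.2) P
  meas : ∀ y j, Measurable (Z y j)
  mem : ∀ y j ω, Z y j ω ∈ Set.Icc (0 : ℝ) 1
  mean : ∀ y j, ∫ ω, Z y j ω ∂P = p y

/-- The average of the row `y`. -/
noncomputable def rowAvg {Ω : Type*} {n : ℕ} (Z : Fin 2 → Fin n → Ω → ℝ) (y : Fin 2) (ω : Ω) : ℝ :=
  (∑ j, Z y j ω) / n

theorem rowAvg_one_sub {Ω : Type*} {n : ℕ} (hn : 0 < n) (Z : Fin 2 → Fin n → Ω → ℝ) (y : Fin 2)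
    (ω : Ω) : rowAvg (fun y j ω => 1 - Z y j ω) y ω = 1 - rowAvg Z y ω := by
  have : (n : ℝ) ≠ 0 := by positivity
  simp [rowAvg, sub_div, this]

namespace UnitArray

variable {Ω : Type*} [MeasurableSpace Ω] {P : Measure Ω} {n : ℕ} {Z : Fin 2 → Fin n → Ω → ℝ}
  {p : Fin 2 → ℝ}

theorem nonneg (h : UnitArray P Z p) (hn : 0 < n) (y : Fin 2) : 0 ≤ p y := by
  rw [← h.mean y ⟨0, hn⟩]
  exact integral_nonneg fun ω => (h.mem _ _ ω).1

variable [IsProbabilityMeasure P]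

/-- Reflection transfers every estimate near level `0` to level `1`. -/
theorem one_sub (h : UnitArray P Z p) :
    UnitArray P (fun y j ω => 1 - Z y j ω) (fun y => 1 - p y) where
  indep := h.indep.comp (fun _ r => 1 - r) fun _ => measurable_const.sub measurable_id
  meas y j := measurable_const.sub (h.meas y j)
  mem y j ω := ⟨sub_nonneg.2 (h.mem y j ω).2, sub_le_self _ (h.mem y j ω).1⟩
  mean y j := by
    rw [integral_sub (integrable_const 1) (integrable_of_mem_Icc (h.meas y j) (h.mem y j)),
      h.mean]
    simp

theorem rowAvg_upper_tail (h : UnitArray P Z p) (hn : 0 < n) (y : Fin 2) {δ : ℝ} (hδ0 : 0 ≤ δ)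
    (hδ1 : δ ≤ 1) :
    P.real {ω | (1 + δ) * p y ≤ rowAvg Z y ω} ≤ Real.exp (-(n * p y * δ ^ 2 / 3)) := by
  have hn' : (0 : ℝ) < n := by positivity
  have := measureReal_one_add_mul_le_sum_le h.indep (fun k => h.meas k.1 k.2)
    (fun k => h.mem k.1 k.2) ({y} ×ˢ Finset.univ) (m := n * p y)
    (by simp [h.mean]) (mul_nonneg hn'.le (h.nonneg hn y)) hδ0 hδ1
  refine le_trans (measureReal_mono fun ω hω => ?_) this
  simp only [Set.mem_ofPred_eq, rowAvg, le_div_iff₀ hn', Finset.sum_product,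
    Finset.sum_singleton] at hω ⊢
  linarith

theorem rowAvg_lower_tail (h : UnitArray P Z p) (hn : 0 < n) (y : Fin 2) {δ : ℝ} (hδ0 : 0 ≤ δ) :
    P.real {ω | rowAvg Z y ω ≤ (1 - δ) * p y} ≤ Real.exp (-(n * p y * δ ^ 2 / 2)) := by
  have hn' : (0 : ℝ) < n := by positivity
  have := measureReal_sum_le_one_sub_mul_le h.indep (fun k => h.meas k.1 k.2)
    (fun k => h.mem k.1 k.2) ({y} ×ˢ Finset.univ) (m := n * p y)
    (by simp [h.mean]) (mul_nonneg hn'.le (h.nonneg hn y)) hδ0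
  refine le_trans (measureReal_mono fun ω hω => ?_) this
  simp only [Set.mem_ofPred_eq, rowAvg, div_le_iff₀ hn', Finset.sum_product,
    Finset.sum_singleton] at hω ⊢
  linarith

/-- Weakened so that both tails share the exponent to which `deltaBar` is tuned. -/
theorem rowAvg_lower_tail' (h : UnitArray P Z p) (hn : 0 < n) (y : Fin 2) {δ : ℝ} (hδ0 : 0 ≤ δ) :
    P.real {ω | rowAvg Z y ω ≤ (1 - δ) * p y} ≤ Real.exp (-(n * p y * δ ^ 2 / 3)) := by
  refine (h.rowAvg_lower_tail hn y hδ0).trans (Real.exp_le_exp.2 ?_)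
  have : 0 ≤ n * p y * δ ^ 2 := by have := h.nonneg hn y; positivity
  linarith

/-- Rows of equal mean have close averages, in ratio. -/
theorem ratio_close (h : UnitArray P Z p) (hn : 0 < n) {q δ : ℝ} (hp : ∀ y, p y = q)
    (hδ0 : 0 ≤ δ) (hδ1 : δ < 1) :
    P.real {ω | ¬ (rowAvg Z 0 ω ≤ (1 + δ) / (1 - δ) * rowAvg Z 1 ω ∧
        rowAvg Z 1 ω ≤ (1 + δ) / (1 - δ) * rowAvg Z 0 ω)}
      ≤ 4 * Real.exp (-(n * q * δ ^ 2 / 3)) := by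
  have hδ : 0 < 1 - δ := by linarith
  have hup : ∀ y, P.real {ω | (1 + δ) * q ≤ rowAvg Z y ω} ≤ Real.exp (-(n * q * δ ^ 2 / 3)) :=
    fun y => by have := h.rowAvg_upper_tail hn y hδ0 hδ1.le; rwa [hp] at this
  have hlo : ∀ y, P.real {ω | rowAvg Z y ω ≤ (1 - δ) * q} ≤ Real.exp (-(n * q * δ ^ 2 / 3)) :=
    fun y => by have := h.rowAvg_lower_tail' hn y hδ0; rwa [hp] at this
  have hsub : {ω | ¬ (rowAvg Z 0 ω ≤ (1 + δ) / (1 - δ) * rowAvg Z 1 ω ∧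
        rowAvg Z 1 ω ≤ (1 + δ) / (1 - δ) * rowAvg Z 0 ω)} ⊆
      ({ω | (1 + δ) * q ≤ rowAvg Z 0 ω} ∪ {ω | (1 + δ) * q ≤ rowAvg Z 1 ω}) ∪
      ({ω | rowAvg Z 0 ω ≤ (1 - δ) * q} ∪ {ω | rowAvg Z 1 ω ≤ (1 - δ) * q}) := by
    intro ω hω
    by_contra hcon
    simp only [Set.mem_union, Set.mem_ofPred_eq, not_or, not_le] at hcon
    obtain ⟨⟨h0, h1⟩, h2, h3⟩ := hcon
    have key : ∀ a b : ℝ, a < (1 + δ) * q → (1 - δ) * q < b → a ≤ (1 + δ) / (1 - δ) * b := by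
      intro a b ha hb
      rw [div_mul_eq_mul_div, le_div_iff₀ hδ]
      nlinarith
    exact hω ⟨key _ _ h0 h3, key _ _ h1 h2⟩
  refine (measureReal_mono hsub).trans ((measureReal_union_le _ _).trans ?_)
  have h1 := measureReal_union_le (μ := P) {ω | (1 + δ) * q ≤ rowAvg Z 0 ω}
    {ω | (1 + δ) * q ≤ rowAvg Z 1 ω}
  have h2 := measureReal_union_le (μ := P) {ω | rowAvg Z 0 ω ≤ (1 - δ) * q}
    {ω | rowAvg Z 1 ω ≤ (1 - δ) * q}
  linarith [hup 0, hup 1, hlo 0, hlo 1]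

/-- Rows with means far apart have averages that are apart, in ratio. -/
theorem ratio_far (h : UnitArray P Z p) (hn : 0 < n) {y y' : Fin 2} {g r δ : ℝ} (hr : 0 < r)
    (hδ0 : 0 ≤ δ) (hδ1 : δ < 1) (hg : 0 < g) (hy : g ≤ p y) (hy' : g ≤ p y')
    (hfar : r * ((1 + δ) / (1 - δ)) < p y / p y') :
    P.real {ω | rowAvg Z y ω ≤ r * rowAvg Z y' ω} ≤ 2 * Real.exp (-(n * g * δ ^ 2 / 3)) := by
  have hδ : 0 < 1 - δ := by linarith
  have hmono : ∀ q, g ≤ q → Real.exp (-(n * q * δ ^ 2 / 3)) ≤ Real.exp (-(n * g * δ ^ 2 / 3)) :=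
    fun q hq => by gcongr
  -- The factor `(1 + δ) / (1 - δ)` in `hfar` absorbs a relative error `δ` in each average.
  have hsub : {ω | rowAvg Z y ω ≤ r * rowAvg Z y' ω} ⊆
      {ω | rowAvg Z y ω ≤ (1 - δ) * p y} ∪ {ω | (1 + δ) * p y' ≤ rowAvg Z y' ω} := by
    intro ω
    contrapose!
    simp only [Set.mem_union, Set.mem_ofPred_eq, not_or, not_le]
    rintro ⟨h0, h1⟩
    rw [lt_div_iff₀ (hg.trans_le hy'), mul_div_assoc', div_mul_eq_mul_div, div_lt_iff₀ hδ] at hfar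
    nlinarith [mul_lt_mul_of_pos_left h1 hr]
  refine (measureReal_mono hsub).trans ((measureReal_union_le _ _).trans ?_)
  linarith [h.rowAvg_upper_tail hn y' hδ0 hδ1.le, h.rowAvg_lower_tail' hn y hδ0, hmono _ hy,
    hmono _ hy']

/-- With Chernoff parameter `1`, the total mean is at most `2ng` against the level `8ng`, and `2(e -
1) - 8 < -3`. -/
theorem pooled_upper_tail (h : UnitArray P Z p) (hn : 0 < n) {g : ℝ} (hg : 0 ≤ g)
    (hp : ∀ y, p y ≤ g) :
    P.real {ω | 4 * g ≤ (rowAvg Z 0 ω + rowAvg Z 1 ω) / 2} ≤ Real.exp (-(3 * n * g)) := by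
  have hn' : (0 : ℝ) < n := by positivity
  have := measureReal_le_sum_le h.indep (fun k => h.meas k.1 k.2)
    (fun k => h.mem k.1 k.2) Finset.univ zero_le_one (8 * n * g)
  refine le_trans (measureReal_mono fun ω hω => ?_) (this.trans (Real.exp_le_exp.2 ?_))
  · simp only [Set.mem_ofPred_eq, rowAvg, ← add_div, Fintype.sum_prod_type, Fin.sum_univ_two]
      at hω ⊢
    rw [div_div, le_div_iff₀ (by positivity)] at hω
    linarith
  · simp only [h.mean, Fintype.sum_prod_type, Fin.sum_univ_two, Finset.sum_const,
      Finset.card_univ, Fintype.card_fin, nsmul_eq_mul]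
    have he := Real.exp_one_lt_d9
    have he' := Real.add_one_le_exp 1
    have h0 : n * p 0 + n * p 1 ≤ 2 * (n * g) := by nlinarith [hp 0, hp 1]
    have hng : 0 ≤ n * g := by positivity
    nlinarith

/-- With Chernoff parameter `1`, the total mean is at least `16ng` against the level `8ng`, and
`16(e⁻¹ - 1) + 8 < -1`. -/
theorem pooled_lower_tail (h : UnitArray P Z p) (hn : 0 < n) {g : ℝ} (hg : 0 ≤ g)
    (hp : ∀ y, 8 * g ≤ p y) :
    P.real {ω | (rowAvg Z 0 ω + rowAvg Z 1 ω) / 2 ≤ 4 * g} ≤ Real.exp (-(n * g)) := by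
  have hn' : (0 : ℝ) < n := by positivity
  have := measureReal_sum_le_le h.indep (fun k => h.meas k.1 k.2)
    (fun k => h.mem k.1 k.2) Finset.univ zero_le_one (8 * n * g)
  refine le_trans (measureReal_mono fun ω hω => ?_) (this.trans (Real.exp_le_exp.2 ?_))
  · simp only [Set.mem_ofPred_eq, rowAvg, ← add_div, Fintype.sum_prod_type, Fin.sum_univ_two]
      at hω ⊢
    rw [div_div, div_le_iff₀ (by positivity)] at hω
    linarith
  · simp only [h.mean, Fintype.sum_prod_type, Fin.sum_univ_two, Finset.sum_const,
      Finset.card_univ, Fintype.card_fin, nsmul_eq_mul]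
    have he := Real.exp_neg_one_lt_d9
    have h0 : 16 * (n * g) ≤ n * p 0 + n * p 1 := by nlinarith [hp 0, hp 1]
    have hng : 0 ≤ n * g := by positivity
    nlinarith

/-- The upper Chernoff bound needs `δ ≤ 1`. For larger `δ` the event lies in the one for `δ = 1`,
which the second term pays for; hence no upper limit on `ε` is needed later. -/
theorem abs_rowAvg_sub_tail (h : UnitArray P Z p) (hn : 0 < n) (y : Fin 2) {δ : ℝ} (hδ0 : 0 ≤ δ) :
    P.real {ω | δ * p y ≤ |rowAvg Z y ω - p y|}
      ≤ 2 * Real.exp (-(n * p y * δ ^ 2 / 3)) + 2 * Real.exp (-(n * p y / 3)) := by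
  have hp := h.nonneg hn y
  have key : ∀ η : ℝ, 0 ≤ η → η ≤ 1 → P.real {ω | η * p y ≤ |rowAvg Z y ω - p y|}
      ≤ 2 * Real.exp (-(n * p y * η ^ 2 / 3)) := by
    intro η hη0 hη1
    have hsub : {ω | η * p y ≤ |rowAvg Z y ω - p y|} ⊆
        {ω | rowAvg Z y ω ≤ (1 - η) * p y} ∪ {ω | (1 + η) * p y ≤ rowAvg Z y ω} := by
      intro ω hω
      rcases le_abs.1 (Set.mem_ofPred_eq ▸ hω) with h | h
      · exact Or.inr (by simp only [Set.mem_ofPred_eq]; linarith)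
      · exact Or.inl (by simp only [Set.mem_ofPred_eq]; linarith)
    refine (measureReal_mono hsub).trans ((measureReal_union_le _ _).trans ?_)
    linarith [h.rowAvg_upper_tail hn y hη0 hη1, h.rowAvg_lower_tail' hn y hη0]
  rcases le_total δ 1 with hδ1 | hδ1
  · linarith [key δ hδ0 hδ1, Real.exp_pos (-(n * p y / 3))]
  · have h1 := key 1 zero_le_one le_rfl
    have h2 : P.real {ω | δ * p y ≤ |rowAvg Z y ω - p y|}
        ≤ P.real {ω | 1 * p y ≤ |rowAvg Z y ω - p y|} :=
      measureReal_mono fun ω hω => (mul_le_mul_of_nonneg_right hδ1 hp).trans hω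
    rw [one_pow, mul_one] at h1
    linarith [Real.exp_pos (-(n * p y * δ ^ 2 / 3))]

/-- The quantile transform of the row average is accurate. -/
theorem quantile_rowAvg_tail (h : UnitArray P Z p) (hn : 0 < n) (y : Fin 2) {g ε : ℝ} (hg : 0 < g)
    (hp0 : 8 * g ≤ p y) (hp1 : p y ≤ 1 - 8 * g) (hε : 0 < ε) :
    P.real {ω | ¬ (normalQuantile (rowAvg Z y ω) - normalQuantile (p y)).abs < ENNReal.ofReal ε}
      ≤ 4 * Real.exp (-(n * g)) +
        2 * Real.exp (-(n * (8 * g) * (ε / Real.sqrt (2 * Real.pi)) ^ 2 / 3)) := by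
  have hs : 0 < Real.sqrt (2 * Real.pi) := by positivity
  set η := ε / Real.sqrt (2 * Real.pi) with hη
  have hη0 : 0 < η := by positivity
  set m := min (p y) (1 - p y) with hm
  have hm8 : 8 * g ≤ m := le_min hp0 (by linarith)
  have hm0 : 0 < m := by linarith
  have hng : 0 < n * g := by positivity
  have hdev : P.real {ω | η * m ≤ |rowAvg Z y ω - p y|}
      ≤ 2 * Real.exp (-(n * m * η ^ 2 / 3)) + 2 * Real.exp (-(n * m / 3)) := by
    -- The deviation is invariant under reflection, so it can be measured relative to the smaller of
    -- `p y` and `1 - p y`.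
    rcases le_total (p y) (1 - p y) with hle | hle
    · rw [hm, min_eq_left hle]
      exact h.abs_rowAvg_sub_tail hn y hη0.le
    · rw [hm, min_eq_right hle]
      have := h.one_sub.abs_rowAvg_sub_tail hn y hη0.le
      simpa only [rowAvg_one_sub hn, sub_sub_sub_cancel_left, abs_sub_comm (p y)] using this
  -- These keep the average at distance at least `m / 2` from `0` and `1`; the `1/2` cancels the `2`
  -- of the quantile estimate, which explains `η`.
  have hlo := h.rowAvg_lower_tail hn y (δ := 1 / 2) (by norm_num)
  have hlo' := h.one_sub.rowAvg_lower_tail hn y (δ := 1 / 2) (by norm_num)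
  simp only [rowAvg_one_sub hn] at hlo'
  have hsub : {ω | ¬ (normalQuantile (rowAvg Z y ω) - normalQuantile (p y)).abs
        < ENNReal.ofReal ε} ⊆
      ({ω | rowAvg Z y ω ≤ (1 - 1 / 2) * p y} ∪ {ω | 1 - rowAvg Z y ω ≤ (1 - 1 / 2) * (1 - p y)}) ∪
      {ω | η * m ≤ |rowAvg Z y ω - p y|} := by
    intro ω hω
    by_contra hcon
    simp only [Set.mem_union, Set.mem_ofPred_eq, not_or, not_le] at hcon
    obtain ⟨⟨h1, h2⟩, h3⟩ := hcon
    simp only [Set.mem_ofPred_eq, not_lt] at hω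
    have hmp : m ≤ p y := min_le_left _ _
    have hmq : m ≤ 1 - p y := min_le_right _ _
    have := le_abs_sub_of_le_abs_normalQuantile_sub (m := m / 2) (by linarith) (by linarith)
      (by linarith) (by linarith) (by linarith) (le_min (by linarith) (by linarith))
      (le_min (by linarith) (by linarith)) hω
    have heq : ε * (2 / Real.sqrt (2 * Real.pi) * (m / 2)) = η * m := by
      rw [hη]; field_simp
    linarith
  refine (measureReal_mono hsub).trans ((measureReal_union_le _ _).trans ?_)
  have hu := measureReal_union_le (μ := P) {ω | rowAvg Z y ω ≤ (1 - 1 / 2) * p y}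
    {ω | 1 - rowAvg Z y ω ≤ (1 - 1 / 2) * (1 - p y)}
  have hn' : (0 : ℝ) < n := by positivity
  -- The margin `8g` is just enough here: `8 · (1/2)² / 2 = 1`.
  have e1 : Real.exp (-(n * p y * (1 / 2) ^ 2 / 2)) ≤ Real.exp (-(n * g)) :=
    Real.exp_le_exp.2 (by nlinarith)
  have e2 : Real.exp (-(n * (1 - p y) * (1 / 2) ^ 2 / 2)) ≤ Real.exp (-(n * g)) :=
    Real.exp_le_exp.2 (by nlinarith)
  have e3 : Real.exp (-(n * m / 3)) ≤ Real.exp (-(n * g)) :=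
    Real.exp_le_exp.2 (by nlinarith)
  have e4 : Real.exp (-(n * m * η ^ 2 / 3)) ≤ Real.exp (-(n * (8 * g) * η ^ 2 / 3)) := by
    gcongr
  linarith

end UnitArray

/-! ### The tuning quantities -/

theorem two_le_of_one_le_aSeq {n : ℕ} {γ : ℝ} (han : 1 ≤ aSeq n γ) : 2 ≤ n := by
  by_contra! h
  -- `Real.log` vanishes at both `0` and `1`, so `aSeq` is `0` there.
  interval_cases n <;> simp [aSeq] at han <;> linarith

theorem aSeq_two_mul_pos {n : ℕ} {γ : ℝ} (hγ : 0 < γ) (hn : 2 ≤ n) : 0 < aSeq (2 * n) γ := by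
  have : (1 : ℝ) < (2 * n : ℕ) := by exact_mod_cast (by omega : 1 < 2 * n)
  exact Real.sqrt_pos.2 (mul_pos hγ (Real.log_pos this))

theorem gFun_two_mul_pos {n : ℕ} {γ : ℝ} (hγ : 0 < γ) (hn : 2 ≤ n) : 0 < gFun (2 * n) γ :=
  div_pos (gaussianPDFReal_pos 0 1 _ one_ne_zero) (mul_pos two_pos (aSeq_two_mul_pos hγ hn))

theorem gFun_eq {n : ℕ} {γ : ℝ} (hγ : 0 < γ) (hn : 0 < n) :
    gFun n γ = (n : ℝ) ^ (-(γ / 2)) / (Real.sqrt (2 * Real.pi) * (2 * aSeq n γ)) := by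
  have hn1 : (1 : ℝ) ≤ n := by exact_mod_cast hn
  have hsq : aSeq n γ ^ 2 = γ * Real.log n :=
    Real.sq_sqrt (mul_nonneg hγ.le (Real.log_nonneg hn1))
  rw [gFun, gaussianPDFReal_def]
  simp only [NNReal.coe_one, mul_one, sub_zero]
  rw [hsq, Real.rpow_def_of_pos (by linarith)]
  have : -(γ * Real.log n) / 2 = Real.log n * -(γ / 2) := by ring
  rw [this]
  field_simp

/-- The quotient is `2^(γ/2) · a_{2n} / a_n`, where `γ < 2` bounds the first factor by `2` and `log
(2n) ≤ 2 log n` gives `a_{2n} ≤ 2 a_n`. This passes from the `g(2n,γ)` of the tests to the `g(n,γ)`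
of the final exponent. -/
theorem gFun_le_eight_mul {n : ℕ} {γ : ℝ} (hγ : 0 < γ) (hγ2 : γ < 2) (hn : 2 ≤ n) :
    gFun n γ ≤ 8 * gFun (2 * n) γ := by
  have hn0 : 0 < n := by omega
  have hn2 : (2 : ℝ) ≤ n := by exact_mod_cast hn
  have hlog : Real.log 2 ≤ Real.log n := Real.log_le_log two_pos hn2
  have hlog2 : 0 < Real.log 2 := Real.log_pos one_lt_two
  have ha : 0 < aSeq n γ := Real.sqrt_pos.2 (mul_pos hγ (by linarith))
  have ha2 : aSeq (2 * n) γ ≤ 2 * aSeq n γ := by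
    rw [aSeq, aSeq, Real.sqrt_le_left (by positivity), mul_pow,
      Real.sq_sqrt (mul_nonneg hγ.le (by linarith)), Nat.cast_mul, Nat.cast_ofNat,
      Real.log_mul two_ne_zero (by positivity)]
    nlinarith
  have hpow : (1 / 2 : ℝ) ≤ 2 ^ (-(γ / 2)) := by
    rw [one_div, ← Real.rpow_neg_one]
    exact Real.rpow_le_rpow_of_exponent_le one_le_two (by linarith)
  have hv : 0 < (n : ℝ) ^ (-(γ / 2)) := by positivity
  have hs : 0 < Real.sqrt (2 * Real.pi) := by positivity
  have ha' := aSeq_two_mul_pos hγ hn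
  rw [gFun_eq hγ hn0, gFun_eq hγ (by omega), Nat.cast_mul, Nat.cast_ofNat,
    Real.mul_rpow zero_le_two (by positivity), mul_div_assoc', div_le_div_iff₀ (by positivity)
    (by positivity)]
  have h1 : aSeq (2 * n) γ ≤ 8 * 2 ^ (-(γ / 2)) * aSeq n γ := by nlinarith
  calc (n : ℝ) ^ (-(γ / 2)) * (Real.sqrt (2 * Real.pi) * (2 * aSeq (2 * n) γ))
      = ((n : ℝ) ^ (-(γ / 2)) * Real.sqrt (2 * Real.pi) * 2) * aSeq (2 * n) γ := by ring
    _ ≤ ((n : ℝ) ^ (-(γ / 2)) * Real.sqrt (2 * Real.pi) * 2) *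
          (8 * 2 ^ (-(γ / 2)) * aSeq n γ) := by gcongr
    _ = _ := by ring

theorem deltaBar_nonneg (n d : ℕ) (γ : ℝ) : 0 ≤ deltaBar n d γ := Real.sqrt_nonneg _

theorem deltaBar_mono {n d d' : ℕ} {γ : ℝ} (hγ : 0 < γ) (hn : 2 ≤ n) (hd : 0 < d) (hdd : d ≤ d') :
    deltaBar n d γ ≤ deltaBar n d' γ := by
  have hg := gFun_two_mul_pos hγ hn
  have hd' : (0 : ℝ) < d := by exact_mod_cast hd
  have hdd' : (d : ℝ) ≤ d' := by exact_mod_cast hdd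
  rw [deltaBar, deltaBar]
  have hn' : (0 : ℝ) < n := by positivity
  gcongr

/-- This identity dictates the form of `deltaBar`. The factor `1/d` pays for the union bound off the
support; on the support `d = 1` is used. -/
theorem exp_deltaBar_sq {n d : ℕ} {γ : ℝ} (hγ : 0 < γ) (hn : 2 ≤ n) (hd : 0 < d) :
    Real.exp (-(n * gFun (2 * n) γ * deltaBar n d γ ^ 2 / 3)) = (n : ℝ) ^ (-(γ / 2)) / d := by
  have hg := gFun_two_mul_pos hγ hn
  have hd' : (1 : ℝ) ≤ d := by exact_mod_cast hd
  have hn' : (1 : ℝ) ≤ n := by exact_mod_cast (by omega : 1 ≤ n)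
  have hpow : 1 ≤ (n : ℝ) ^ (γ / 2) := Real.one_le_rpow hn' (by linarith)
  have hL : 0 ≤ Real.log (d * (n : ℝ) ^ (γ / 2)) :=
    Real.log_nonneg (one_le_mul_of_one_le_of_one_le hd' hpow)
  have hn0 : (0 : ℝ) < n := by linarith
  rw [deltaBar, Real.sq_sqrt (by positivity)]
  have : n * gFun (2 * n) γ * (3 * (n : ℝ)⁻¹ * (gFun (2 * n) γ)⁻¹ *
      Real.log (d * (n : ℝ) ^ (γ / 2))) / 3 = Real.log (d * (n : ℝ) ^ (γ / 2)) := by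
    field_simp
  rw [this, Real.exp_neg, Real.exp_log (by positivity), Real.rpow_neg hn0.le, mul_inv]
  field_simp

/-- `J₁` collects `1 / (2√(2π))` from `g(n,γ)`, `1 / (2π)` from the squared quantile scale, and the
Chernoff `1/3`. -/
theorem J₁_exponent_le {n : ℕ} {γ ε : ℝ} (hγ : 0 < γ) (hγ2 : γ < 2) (hn : 2 ≤ n) :
    J₁ * ((n : ℝ) ^ (1 - γ / 2) * ε ^ 2 / Real.sqrt (γ * Real.log n))
      ≤ n * (8 * gFun (2 * n) γ) * (ε / Real.sqrt (2 * Real.pi)) ^ 2 / 3 := by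
  have hn0 : (0 : ℝ) < n := by positivity
  have hs : 0 < Real.sqrt (2 * Real.pi) := by positivity
  have hs2 : Real.sqrt (2 * Real.pi) ^ 2 = 2 * Real.pi := Real.sq_sqrt (by positivity)
  have hpi := Real.pi_pos
  have h := gFun_le_eight_mul hγ hγ2 hn
  rw [sub_eq_add_neg, Real.rpow_add hn0, Real.rpow_one, ← aSeq]
  calc J₁ * (n * (n : ℝ) ^ (-(γ / 2)) * ε ^ 2 / aSeq n γ)
      = n * gFun n γ * (ε / Real.sqrt (2 * Real.pi)) ^ 2 / 3 := by
        rw [gFun_eq hγ (by omega), J₁, div_pow, hs2]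
        have ha : 0 < aSeq n γ := Real.sqrt_pos.2 (mul_pos hγ (Real.log_pos
          (by exact_mod_cast (by omega : 1 < n))))
        field_simp
        ring
    _ ≤ _ := by gcongr

/-! ### Deterministic properties of the estimators -/

theorem extDiff_eq_zero_iff {a b : EReal} : extDiff a b = 0 ↔ a = b := by
  by_cases h : a = b
  · simp [extDiff, h]
  · simp only [extDiff, h, if_false, iff_false]
    induction a <;> induction b <;> simp_all [← EReal.coe_sub, sub_eq_zero]

/-- The division-free form agrees with the conventions at `0`: in `ℝ≥0∞`, `0 / 0 = 0` passes the
bound and `c / 0 = ∞` with `c > 0` fails it. -/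
theorem maxMinRatio_le_iff {a b r : ℝ} (ha : 0 ≤ a) (hb : 0 ≤ b) (hr : 1 ≤ r) :
    maxMinRatio a b ≤ ENNReal.ofReal r ↔ a ≤ r * b ∧ b ≤ r * a := by
  wlog hab : a ≤ b generalizing a b
  · rw [and_comm, ← this hb ha (le_of_not_ge hab), maxMinRatio, maxMinRatio, max_comm, min_comm]
  have hb' : a ≤ r * b := hab.trans (le_mul_of_one_le_left hb hr)
  rw [maxMinRatio, max_eq_right hab, min_eq_left hab, and_iff_right hb']
  rcases ha.eq_or_lt with rfl | ha'
  · rcases hb.eq_or_lt with rfl | hb0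
    · simp
    · simp [ENNReal.div_zero, hb0]
  · rw [← ENNReal.ofReal_div_of_pos ha', ENNReal.ofReal_le_ofReal_iff (by linarith),
      div_le_iff₀ ha']

theorem empF_mem_Icc {n d : ℕ} (D : Fin 2 → Fin n → Fin d → ℝ) (i : Fin d) (y : Fin 2) (t : ℝ) :
    empF D i y t ∈ Set.Icc (0 : ℝ) 1 := by
  refine ⟨div_nonneg (Finset.sum_nonneg fun j _ => ?_) n.cast_nonneg,
    div_le_one_of_le₀ ?_ n.cast_nonneg⟩
  · split_ifs <;> norm_num
  · refine (Finset.sum_le_sum (g := fun _ => (1 : ℝ)) fun j _ => ?_).trans (by simp)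
    split_ifs <;> norm_num

theorem closenessTest_iff {n d : ℕ} (D : Fin 2 → Fin n → Fin d → ℝ) {γ : ℝ} (i : Fin d) (t : ℝ)
    (hδ : deltaBar n d γ < 1) :
    ClosenessTest D γ i t ↔
      (empF D i 0 t ≤ (1 + deltaBar n d γ) / (1 - deltaBar n d γ) * empF D i 1 t ∧
        empF D i 1 t ≤ (1 + deltaBar n d γ) / (1 - deltaBar n d γ) * empF D i 0 t) ∧
      (1 - empF D i 0 t ≤ (1 + deltaBar n d γ) / (1 - deltaBar n d γ) * (1 - empF D i 1 t) ∧
        1 - empF D i 1 t ≤ (1 + deltaBar n d γ) / (1 - deltaBar n d γ) * (1 - empF D i 0 t)) := by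
  have h0 := empF_mem_Icc D i 0 t
  have h1 := empF_mem_Icc D i 1 t
  have hr : 1 ≤ (1 + deltaBar n d γ) / (1 - deltaBar n d γ) := by
    rw [one_le_div (by linarith)]
    linarith [deltaBar_nonneg n d γ]
  rw [ClosenessTest, max_le_iff, maxMinRatio_le_iff h0.1 h1.1 hr,
    maxMinRatio_le_iff (sub_nonneg.2 h0.2) (sub_nonneg.2 h1.2) hr]

/-- If the closeness test fails, the empirical levels differ, and so do their quantiles, even
infinite ones; the untruncated difference thus never vanishes by accident. -/
theorem deltaAlphaTilde_ne_zero_iff {n d : ℕ} (D : Fin 2 → Fin n → Fin d → ℝ) {γ : ℝ} (i : Fin d)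
    (t : ℝ) (hδ : deltaBar n d γ < 1) :
    deltaAlphaTilde D γ i t ≠ 0 ↔ ¬ BoundaryTest D γ i t ∧ ¬ ClosenessTest D γ i t := by
  rw [deltaAlphaTilde]
  split_ifs with h
  · simp only [ne_eq, not_true_eq_false, false_iff]
    tauto
  · rw [not_or] at h
    simp only [ne_eq, extDiff_eq_zero_iff, h.1, h.2, not_false_eq_true, and_self, iff_true]
    intro hα
    have heq := normalQuantile_injOn (empF_mem_Icc D i 0 t) (empF_mem_Icc D i 1 t) hα
    refine h.2 ((closenessTest_iff D i t hδ).2 ?_)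
    have h1 := empF_mem_Icc D i 1 t
    have hr : 1 ≤ (1 + deltaBar n d γ) / (1 - deltaBar n d γ) := by
      rw [one_le_div (by linarith)]
      linarith [deltaBar_nonneg n d γ]
    rw [heq]
    have e1 := le_mul_of_one_le_left h1.1 hr
    have e2 := le_mul_of_one_le_left (sub_nonneg.2 h1.2) hr
    exact ⟨⟨e1, e1⟩, e2, e2⟩

theorem deltaAlphaTilde_eq_extDiff {n d : ℕ} {D : Fin 2 → Fin n → Fin d → ℝ} {γ : ℝ} {i : Fin d}
    {t : ℝ} (h : deltaAlphaTilde D γ i t ≠ 0) :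
    deltaAlphaTilde D γ i t = extDiff (alphaHat D i 0 t) (alphaHat D i 1 t) := by
  rw [deltaAlphaTilde] at h ⊢
  split_ifs at h ⊢
  · exact absurd rfl h
  · rfl

theorem popF_eq_of_deltaAlpha_eq_zero {d : ℕ} {μ : Fin 2 → Measure (Fin d → ℝ)} {i : Fin d} {t : ℝ}
    (h : deltaAlpha μ i t = 0) : popF μ i 0 t = popF μ i 1 t :=
  normalQuantile_injOn ⟨cdf_nonneg _ _, cdf_le_one _ _⟩ ⟨cdf_nonneg _ _, cdf_le_one _ _⟩
    (extDiff_eq_zero_iff.1 h)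

/-- A finite error against a finite target forces `a'` and `b'` to be finite, so the claim is the
triangle inequality in `ℝ`. -/
theorem abs_extDiff_sub_extDiff_lt {a b a' b' : EReal} {ε : ℝ} (hε : 0 < ε)
    (ha : (a' - a).abs < ENNReal.ofReal ε) (hb : (b' - b).abs < ENNReal.ofReal ε)
    (hfa : ∃ r : ℝ, a = r) (hfb : ∃ r : ℝ, b = r) :
    (extDiff a' b' - extDiff a b).abs < ENNReal.ofReal (2 * ε) := by
  have hext : ∀ r s : ℝ, extDiff (r : EReal) (s : EReal) = ((r - s : ℝ) : EReal) := by
    intro r s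
    by_cases h : r = s <;> simp [extDiff, h]
  obtain ⟨r, rfl⟩ := hfa
  obtain ⟨s, rfl⟩ := hfb
  have hfin : ∀ (c : EReal) (r : ℝ), (c - r).abs < ENNReal.ofReal ε →
      ∃ u : ℝ, c = u ∧ |u - r| < ε := by
    intro c r hc
    induction c with
    | bot => simp at hc
    | top => simp at hc
    | coe u =>
      rw [← EReal.coe_sub, EReal.abs_def, ENNReal.ofReal_lt_ofReal_iff hε] at hc
      exact ⟨u, rfl, hc⟩
  obtain ⟨u, rfl, hu⟩ := hfin _ _ ha
  obtain ⟨v, rfl, hv⟩ := hfin _ _ hb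
  rw [hext, hext, ← EReal.coe_sub, EReal.abs_def, ENNReal.ofReal_lt_ofReal_iff (by linarith),
    abs_lt]
  rw [abs_lt] at hu hv
  constructor <;> linarith [hu.1, hu.2, hv.1, hv.2]

/-! ### The samples -/

/-- The indicators of the events `X^{y,j}_i ≤ t`. -/
noncomputable def belowIndicator {Ω : Type*} {n d : ℕ} (X : Fin 2 → Fin n → Ω → Fin d → ℝ)
    (i : Fin d) (t : ℝ) (y : Fin 2) (j : Fin n) (ω : Ω) : ℝ := if X y j ω i ≤ t then 1 else 0

theorem empF_eq_rowAvg {Ω : Type*} {n d : ℕ} (X : Fin 2 → Fin n → Ω → Fin d → ℝ)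
    (i : Fin d) (y : Fin 2) (t : ℝ) (ω : Ω) :
    empF (fun y j => X y j ω) i y t = rowAvg (belowIndicator X i t) y ω := rfl

theorem unitArray_belowIndicator {Ω : Type*} [MeasurableSpace Ω] {P : Measure Ω}
    [IsProbabilityMeasure P] {n d : ℕ} {μ : Fin 2 → Measure (Fin d → ℝ)}
    [∀ y, IsProbabilityMeasure (μ y)] {X : Fin 2 → Fin n → Ω → Fin d → ℝ}
    (hXmeas : ∀ y j, Measurable (X y j)) (hXlaw : ∀ y j, P.map (X y j) = μ y)
    (hXindep : iIndepFun (fun p : Fin 2 × Fin n => X p.1 p.2) P) (i : Fin d) (t : ℝ) :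
    UnitArray P (belowIndicator X i t) (fun y => popF μ i y t) := by
  have hset : MeasurableSet {x : Fin d → ℝ | x i ≤ t} :=
    measurableSet_le (measurable_pi_apply i) measurable_const
  have hind : Measurable (fun x : Fin d → ℝ => if x i ≤ t then (1 : ℝ) else 0) :=
    Measurable.ite hset measurable_const measurable_const
  refine ⟨hXindep.comp (fun _ x => if x i ≤ t then (1 : ℝ) else 0) fun _ => hind,
    fun y j => hind.comp (hXmeas y j), fun y j ω => ?_, fun y j => ?_⟩
  · rw [belowIndicator]
    split_ifs <;> simp
  · have hprob : IsProbabilityMeasure ((μ y).map (fun x : Fin d → ℝ => x i)) :=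
      Measure.isProbabilityMeasure_map (measurable_pi_apply i).aemeasurable
    have hset' : MeasurableSet {ω | X y j ω i ≤ t} := hXmeas y j hset
    have heq : belowIndicator X i t y j = Set.indicator {ω | X y j ω i ≤ t} 1 := by
      funext ω
      simp [belowIndicator, Set.indicator_apply]
    rw [popF, cdf_eq_real, map_measureReal_apply (measurable_pi_apply i) measurableSet_Iic,
      ← hXlaw y j, heq, integral_indicator_one hset',
      map_measureReal_apply (hXmeas y j) (measurable_pi_apply i measurableSet_Iic)]
    rfl

/-! ### Error probabilities of the sparse estimator at one coordinate -/

section Coordinate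

variable {Ω : Type*} [MeasurableSpace Ω] {P : Measure Ω} [IsProbabilityMeasure P] {n d : ℕ} {γ : ℝ}
  {μ : Fin 2 → Measure (Fin d → ℝ)} {X : Fin 2 → Fin n → Ω → Fin d → ℝ} {i : Fin d} {t : ℝ}

/-- The false positive bound. An extreme common level is caught by the boundary test, any other by
the closeness test, whose two ratios contribute `4 + 4`. -/
theorem measureReal_deltaAlphaTilde_ne_zero_le
    (h : UnitArray P (belowIndicator X i t) (fun y => popF μ i y t))
    (hγ : 0 < γ) (hn : 2 ≤ n) (hδ : deltaBar n d γ < 1)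
    (hsize : (d : ℝ) / 8 * Real.exp (-(3 * n * gFun (2 * n) γ)) ≤ (n : ℝ) ^ (-(γ / 2)))
    (hzero : deltaAlpha μ i t = 0) :
    P.real {ω | deltaAlphaTilde (fun y j => X y j ω) γ i t ≠ 0}
      ≤ 8 * ((n : ℝ) ^ (-(γ / 2)) / d) := by
  have hn0 : 0 < n := by omega
  have hd : 0 < d := i.pos
  have hd' : (0 : ℝ) < d := by exact_mod_cast hd
  have hg := gFun_two_mul_pos hγ hn
  have hsize' : Real.exp (-(3 * n * gFun (2 * n) γ)) ≤ 8 * ((n : ℝ) ^ (-(γ / 2)) / d) := by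
    rw [mul_div_assoc', le_div_iff₀ hd']
    linarith
  have hpop := popF_eq_of_deltaAlpha_eq_zero hzero
  have hy : ∀ y, popF μ i y t = popF μ i 1 t := by
    intro y
    fin_cases y
    · exact hpop
    · rfl
  simp only [deltaAlphaTilde_ne_zero_iff _ i t hδ, closenessTest_iff _ i t hδ, BoundaryTest,
    empFMarg, empF_eq_rowAvg]
  rcases le_total (popF μ i 1 t) (gFun (2 * n) γ) with hlo | hlo
  · refine le_trans (measureReal_mono fun ω hω => ?_)
      ((h.pooled_upper_tail hn0 hg.le fun y => (hy y).trans_le hlo).trans hsize')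
    simp only [Set.mem_ofPred_eq, not_or, not_le] at hω ⊢
    exact hω.1.1.le
  rcases le_total (1 - popF μ i 1 t) (gFun (2 * n) γ) with hhi | hhi
  · refine le_trans (measureReal_mono fun ω hω => ?_)
      ((h.one_sub.pooled_upper_tail hn0 hg.le fun y => ?_).trans hsize')
    · simp only [Set.mem_ofPred_eq, not_or, not_le, ge_iff_le, rowAvg_one_sub hn0] at hω ⊢
      linarith [hω.1.2]
    · rw [hy y]
      exact hhi
  have hδ0 := deltaBar_nonneg n d γ
  have hexp : ∀ q, gFun (2 * n) γ ≤ q →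
      Real.exp (-(n * q * deltaBar n d γ ^ 2 / 3)) ≤ (n : ℝ) ^ (-(γ / 2)) / d := by
    intro q hq
    rw [← exp_deltaBar_sq hγ hn hd]
    gcongr
  have h1 := h.ratio_close hn0 hy hδ0 hδ
  have h2 := h.one_sub.ratio_close hn0 (q := 1 - popF μ i 1 t) (fun y => by rw [hy y]) hδ0 hδ
  simp only [rowAvg_one_sub hn0] at h2
  refine le_trans (measureReal_mono fun ω hω => ?_)
    ((measureReal_union_le _ _).trans ((add_le_add h1 h2).trans ?_))
  · exact not_and_or.1 hω.2
  · linarith [hexp _ hlo, hexp _ hhi]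

/-- The false negative bound: at most `1/2` unit of `n^(-γ/2)` for the boundary test and `2` for the
closeness test. -/
theorem measureReal_deltaAlphaTilde_eq_zero_le
    (h : UnitArray P (belowIndicator X i t) (fun y => popF μ i y t))
    (hγ : 0 < γ) (hn : 2 ≤ n) (hδ : deltaBar n d γ < 1)
    (hsize : 4 * Real.exp (-(n * gFun (2 * n) γ)) ≤ (n : ℝ) ^ (-(γ / 2)))
    (hmod : ∀ y, t ∈ moderateSet μ n γ i y) (hsig : t ∈ signalSet μ n γ i) :
    P.real {ω | deltaAlphaTilde (fun y j => X y j ω) γ i t = 0} ≤ 3 * (n : ℝ) ^ (-(γ / 2)) := by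
  have hn0 : 0 < n := by omega
  have hd : 0 < d := i.pos
  have hg := gFun_two_mul_pos hγ hn
  have hδ0 := deltaBar_nonneg n d γ
  have hδ1 : deltaBar n 1 γ < 1 := (deltaBar_mono hγ hn one_pos hd).trans_lt hδ
  have hr : 0 < (1 + deltaBar n d γ) / (1 - deltaBar n d γ) :=
    div_pos (by linarith) (by linarith)
  -- The first factor is the threshold of the test; the second is the room for fluctuation required
  -- by `ratio_far`.
  have hthr : signalThreshold n d γ = (1 + deltaBar n d γ) / (1 - deltaBar n d γ) *
      ((1 + deltaBar n 1 γ) / (1 - deltaBar n 1 γ)) := by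
    rw [signalThreshold, div_mul_div_comm]
  have hge : ∀ y, gFun (2 * n) γ ≤ popF μ i y t := fun y => by linarith [(hmod y).1]
  have hge' : ∀ y, gFun (2 * n) γ ≤ 1 - popF μ i y t := fun y => by linarith [(hmod y).2]
  have hexp := exp_deltaBar_sq hγ hn one_pos
  rw [Nat.cast_one, div_one] at hexp
  have hfar : ∀ y y', signalThreshold n d γ < popF μ i y t / popF μ i y' t →
      P.real {ω | empF (fun y j => X y j ω) i y t ≤
        (1 + deltaBar n d γ) / (1 - deltaBar n d γ) * empF (fun y j => X y j ω) i y' t}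
      ≤ 2 * (n : ℝ) ^ (-(γ / 2)) := by
    intro y y' hyy
    rw [hthr] at hyy
    have := h.ratio_far hn0 hr (deltaBar_nonneg n 1 γ) hδ1 hg (hge y) (hge y') hyy
    rwa [hexp] at this
  have hfar' : ∀ y y', signalThreshold n d γ < (1 - popF μ i y t) / (1 - popF μ i y' t) →
      P.real {ω | 1 - empF (fun y j => X y j ω) i y t ≤
        (1 + deltaBar n d γ) / (1 - deltaBar n d γ) * (1 - empF (fun y j => X y j ω) i y' t)}
      ≤ 2 * (n : ℝ) ^ (-(γ / 2)) := by
    intro y y' hyy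
    rw [hthr] at hyy
    have := h.one_sub.ratio_far hn0 hr (deltaBar_nonneg n 1 γ) hδ1 hg (hge' y) (hge' y') hyy
    simp only [rowAvg_one_sub hn0] at this
    rwa [hexp] at this
  have hclose : P.real {ω | ClosenessTest (fun y j => X y j ω) γ i t}
      ≤ 2 * (n : ℝ) ^ (-(γ / 2)) := by
    simp only [closenessTest_iff _ i t hδ]
    -- The closeness test is a conjunction of four inequalities, so violating a single one suffices.
    rcases hsig with hs | hs | hs | hs
    · exact (measureReal_mono fun ω hω => hω.1.1).trans (hfar _ _ hs)
    · exact (measureReal_mono fun ω hω => hω.1.2).trans (hfar _ _ hs)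
    · exact (measureReal_mono fun ω hω => hω.2.1).trans (hfar' _ _ hs)
    · exact (measureReal_mono fun ω hω => hω.2.2).trans (hfar' _ _ hs)
  have hb1 : P.real {ω | empFMarg (fun y j => X y j ω) i t ≤ 4 * gFun (2 * n) γ}
      ≤ Real.exp (-(n * gFun (2 * n) γ)) :=
    h.pooled_lower_tail hn0 hg.le fun y => (hmod y).1
  have hb2 : P.real {ω | empFMarg (fun y j => X y j ω) i t ≥ 1 - 4 * gFun (2 * n) γ}
      ≤ Real.exp (-(n * gFun (2 * n) γ)) := by
    refine le_trans (measureReal_mono fun ω hω => ?_)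
      (h.one_sub.pooled_lower_tail hn0 hg.le fun y => by linarith [(hmod y).2])
    simp only [Set.mem_ofPred_eq, rowAvg_one_sub hn0, empFMarg, empF_eq_rowAvg] at hω ⊢
    linarith
  have hsub : {ω | deltaAlphaTilde (fun y j => X y j ω) γ i t = 0} ⊆
      ({ω | empFMarg (fun y j => X y j ω) i t ≤ 4 * gFun (2 * n) γ} ∪
        {ω | empFMarg (fun y j => X y j ω) i t ≥ 1 - 4 * gFun (2 * n) γ}) ∪
      {ω | ClosenessTest (fun y j => X y j ω) γ i t} := by
    intro ω hω
    by_contra hcon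
    rw [Set.mem_union, not_or] at hcon
    exact (deltaAlphaTilde_ne_zero_iff _ i t hδ).2 hcon hω
  refine (measureReal_mono hsub).trans ((measureReal_union_le _ _).trans ?_)
  have hu := measureReal_union_le (μ := P)
    {ω | empFMarg (fun y j => X y j ω) i t ≤ 4 * gFun (2 * n) γ}
    {ω | empFMarg (fun y j => X y j ω) i t ≥ 1 - 4 * gFun (2 * n) γ}
  linarith [Real.exp_pos (-(n * gFun (2 * n) γ))]

theorem measureReal_not_abs_alphaHat_sub_alpha_lt_le
    (h : UnitArray P (belowIndicator X i t) (fun y => popF μ i y t))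
    (hγ : 0 < γ) (hγ2 : γ < 2) (hn : 2 ≤ n)
    (hsize : 4 * Real.exp (-(n * gFun (2 * n) γ)) ≤ (n : ℝ) ^ (-(γ / 2))) {y : Fin 2}
    (hmod : t ∈ moderateSet μ n γ i y) {ε : ℝ} (hε : 0 < ε) :
    P.real {ω | ¬ (alphaHat (fun y j => X y j ω) i y t - alpha μ i y t).abs < ENNReal.ofReal ε}
      ≤ (n : ℝ) ^ (-(γ / 2)) + 2 *
        Real.exp (-(J₁ * ((n : ℝ) ^ (1 - γ / 2) * ε ^ 2 / Real.sqrt (γ * Real.log n)))) := by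
  have := h.quantile_rowAvg_tail (by omega) y (gFun_two_mul_pos hγ hn) hmod.1 hmod.2 hε
  refine this.trans (add_le_add hsize ?_)
  gcongr
  exact J₁_exponent_le hγ hγ2 hn

end Coordinate

/-! ### Union bounds over the coordinates -/

theorem one_sub_le_measureReal_of_compl_le {Ω : Type*} [MeasurableSpace Ω] {P : Measure Ω}
    [IsProbabilityMeasure P] {s : Set Ω} {b : ℝ} (h : P.real sᶜ ≤ b) : 1 - b ≤ P.real s := by
  have h1 := measureReal_union_le (μ := P) s sᶜ
  rw [Set.union_compl_self, probReal_univ] at h1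
  linarith

theorem measureReal_biUnion_le_card_mul {Ω ι : Type*} [MeasurableSpace Ω] {P : Measure Ω}
    (s : Finset ι) {f : ι → Set Ω} {b : ℝ} (h : ∀ i ∈ s, P.real (f i) ≤ b) :
    P.real (⋃ i ∈ s, f i) ≤ s.card * b :=
  (measureReal_biUnion_finset_le s f).trans (by simpa using Finset.sum_le_sum h)

end CopulaClassif

open CopulaClassif
theorem mainTheorem9 {Ω : Type*} [MeasurableSpace Ω] (P : Measure Ω) [IsProbabilityMeasure P]
    (n d : ℕ) (γ : ℝ) (hγ0 : 0 < γ) (hγ2 : γ < 2)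
    -- the laws of the two classes
    (μ : Fin 2 → Measure (Fin d → ℝ)) [∀ y, IsProbabilityMeasure (μ y)]
    -- the two samples of size `n`, all `2n` vectors being independent
    (X : Fin 2 → Fin n → Ω → Fin d → ℝ)
    (hXmeas : ∀ y j, Measurable (X y j))
    (hXlaw : ∀ y j, P.map (X y j) = μ y)
    (hXindep : iIndepFun (fun p : Fin 2 × Fin n => X p.1 p.2) P)
    (han : 1 ≤ aSeq n γ)
    (hδ : deltaBar n d γ < 1)
    (hn : SampleSizeCondition n d γ)
    (x : Fin d → ℝ) (hx : x ∈ goodPoints μ n γ) :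
    (∀ i ∈ suppSet μ x,
      P.real {ω | deltaAlphaTilde (fun y j => X y j ω) γ i (x i) ≠ 0}
        ≥ 1 - 3 * (n : ℝ) ^ (-(γ / 2))) ∧
    P.real {ω | suppSetTilde (fun y j => X y j ω) γ x = suppSet μ x}
      ≥ 1 - (3 * ((suppSet μ x).ncard : ℝ) + 8) * (n : ℝ) ^ (-(γ / 2)) ∧
    ∀ ε : ℝ, 0 < ε →
      P.real {ω | AccuracyEvent (fun y j => X y j ω) μ γ x ε}
        ≥ 1 - (5 * ((suppSet μ x).ncard : ℝ) + 8) * (n : ℝ) ^ (-(γ / 2))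
          - 4 * ((suppSet μ x).ncard : ℝ) *
            Real.exp (-(J₁ * ((n : ℝ) ^ (1 - γ / 2) * ε ^ 2 / Real.sqrt (γ * Real.log n)))) := by
  classical
  have hn2 : 2 ≤ n := two_le_of_one_le_aSeq han
  have hg := gFun_two_mul_pos hγ0 hn2
  obtain ⟨hn', -⟩ := max_le_iff.1 hn
  obtain ⟨hsize, hsize'⟩ := max_le_iff.1 hn'
  obtain ⟨hmod, hsig⟩ := hx
  have harr := fun i => unitArray_belowIndicator hXmeas hXlaw hXindep i (x i)
  have hmod' : ∀ i ∈ suppSet μ x, ∀ y, x i ∈ moderateSet μ n γ i y := by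
    intro i hi y
    fin_cases y
    · exact (hmod i hi).1
    · exact (hmod i hi).2
  set v := (n : ℝ) ^ (-(γ / 2)) with hv
  have hv0 : 0 ≤ v := by positivity
  have hneg : ∀ i ∈ suppSet μ x,
      P.real {ω | deltaAlphaTilde (fun y j => X y j ω) γ i (x i) = 0} ≤ 3 * v := fun i hi =>
    measureReal_deltaAlphaTilde_eq_zero_le (harr i) hγ0 hn2 hδ hsize' (hmod' i hi) (hsig i hi)
  have hpos : ∀ i ∉ suppSet μ x,
      P.real {ω | deltaAlphaTilde (fun y j => X y j ω) γ i (x i) ≠ 0} ≤ 8 * (v / d) :=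
    fun i hi => measureReal_deltaAlphaTilde_ne_zero_le (harr i) hγ0 hn2 hδ hsize (not_not.1 hi)
  have hcard : ((suppSet μ x).ncard : ℝ) = (suppSet μ x).toFinset.card := by
    rw [Set.ncard_eq_toFinset_card']
  have hsupp : P.real {ω | suppSetTilde (fun y j => X y j ω) γ x = suppSet μ x}ᶜ
      ≤ (3 * ((suppSet μ x).ncard : ℝ) + 8) * v := by
    have hsub : {ω | suppSetTilde (fun y j => X y j ω) γ x = suppSet μ x}ᶜ ⊆
        (⋃ i ∈ (suppSet μ x).toFinset,
          {ω | deltaAlphaTilde (fun y j => X y j ω) γ i (x i) = 0}) ∪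
        ⋃ i ∈ (suppSet μ x).toFinsetᶜ,
          {ω | deltaAlphaTilde (fun y j => X y j ω) γ i (x i) ≠ 0} := by
      intro ω hω
      by_contra hcon
      simp only [Set.mem_union, Set.mem_iUnion, Set.mem_toFinset, Finset.mem_compl, not_or,
        not_exists] at hcon
      refine hω (Set.ext fun i => ⟨fun hi => ?_, fun hi => hcon.1 i hi⟩)
      by_contra hi'
      exact hcon.2 i hi' hi
    have h1 := measureReal_biUnion_le_card_mul (suppSet μ x).toFinset
      fun i hi => hneg i (Set.mem_toFinset.1 hi)
    have h2 := measureReal_biUnion_le_card_mul (suppSet μ x).toFinsetᶜ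
      fun i hi => hpos i (fun h => Finset.mem_compl.1 hi (Set.mem_toFinset.2 h))
    have h3 : ((suppSet μ x).toFinsetᶜ.card : ℝ) * (8 * (v / d)) ≤ 8 * v := by
      have hle : ((suppSet μ x).toFinsetᶜ.card : ℝ) ≤ d := by
        exact_mod_cast (Finset.card_le_univ _).trans_eq (Fintype.card_fin d)
      calc ((suppSet μ x).toFinsetᶜ.card : ℝ) * (8 * (v / d)) ≤ d * (8 * (v / d)) := by gcongr
        _ = 8 * (d / d * v) := by ring
        -- An inequality rather than an equality, since `d / d = 0` when `d = 0`.
        _ ≤ 8 * (1 * v) := by gcongr; exact div_self_le_one _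
        _ = 8 * v := by ring
    refine (measureReal_mono hsub).trans ((measureReal_union_le _ _).trans ?_)
    rw [hcard]
    linarith
  refine ⟨fun i hi => ?_, one_sub_le_measureReal_of_compl_le hsupp, fun ε hε => ?_⟩
  · refine one_sub_le_measureReal_of_compl_le ((measureReal_mono fun ω hω => ?_).trans (hneg i hi))
    exact not_not.1 hω
  set E := Real.exp (-(J₁ * ((n : ℝ) ^ (1 - γ / 2) * ε ^ 2 / Real.sqrt (γ * Real.log n)))) with hE
  rw [sub_sub]
  refine one_sub_le_measureReal_of_compl_le ?_
  have hacc : ∀ i ∈ (suppSet μ x).toFinset, P.real (⋃ y ∈ (Finset.univ : Finset (Fin 2)),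
      {ω | ¬ (alphaHat (fun y j => X y j ω) i y (x i) - alpha μ i y (x i)).abs
        < ENNReal.ofReal ε}) ≤ 2 * (v + 2 * E) := fun i hi =>
    (measureReal_biUnion_le_card_mul Finset.univ fun y _ =>
      measureReal_not_abs_alphaHat_sub_alpha_lt_le (harr i) hγ0 hγ2 hn2 hsize'
        (hmod' i (Set.mem_toFinset.1 hi) y) hε).trans_eq (by simp [hv, hE])
  have hsub : {ω | AccuracyEvent (fun y j => X y j ω) μ γ x ε}ᶜ ⊆
      {ω | suppSetTilde (fun y j => X y j ω) γ x = suppSet μ x}ᶜ ∪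
      ⋃ i ∈ (suppSet μ x).toFinset, ⋃ y ∈ (Finset.univ : Finset (Fin 2)),
        {ω | ¬ (alphaHat (fun y j => X y j ω) i y (x i) - alpha μ i y (x i)).abs
          < ENNReal.ofReal ε} := by
    intro ω hω
    by_contra hcon
    simp only [Set.mem_union, Set.mem_compl_iff, Set.mem_ofPred_eq, Set.mem_iUnion,
      Set.mem_toFinset, Finset.mem_univ, exists_true_left, not_or, not_not, not_exists] at hcon
    obtain ⟨heq, hα⟩ := hcon
    refine hω ⟨heq, fun i hi => ⟨fun y => hα i hi y, ?_⟩⟩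
    have hfin : ∀ y, ∃ r : ℝ, alpha μ i y (x i) = r := by
      intro y
      have hm := hmod' i hi y
      obtain ⟨z, hz⟩ := exists_gaussian_cdf_eq (p := popF μ i y (x i)) (by linarith [hm.1])
        (by linarith [hm.2])
      exact ⟨z, by rw [alpha, ← hz, normalQuantile_cdf]⟩
    -- Exact support recovery ensures that the estimate at `i` is the untruncated difference.
    have hne : i ∈ suppSetTilde (fun y j => X y j ω) γ x := heq ▸ hi
    rw [deltaAlphaTilde_eq_extDiff hne]
    exact abs_extDiff_sub_extDiff_lt hε (hα i hi 0) (hα i hi 1) (hfin 0) (hfin 1)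
  refine (measureReal_mono hsub).trans ((measureReal_union_le _ _).trans ?_)
  -- With `s` the support size, `s · 2(v + 2E)` is added to the `(3s + 8)v` of support recovery.
  have h1 := measureReal_biUnion_le_card_mul _ hacc
  rw [← hcard] at h1
  linarith
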